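/- **Graphs and tree width.** A graph $G=(V,E,\mathrm{ends})$ consists of finite sets $V,E$ and a function $\mathrm{ends}$ from $E$ to the set of subsets of $V$ with one or two elements (so loops and parallel edges are allowed). A tree decomposition of $G$ is a pair $(Y,t)$ of a finite (nonempty) tree $Y$ and a function $t$ from the nodes of $Y$ to the subsets of $V$ such that $\bigcup_i t(i)=V$; every edge $e$ has $\mathrm{ends}(e)\subseteq t(i)$ for some node $i$; and $t(i)\cap t(k)\subseteq t(j)$ whenever $j$ lies on the path of $Y$ from $i$ to $k$. Its width is $\max_i |t(i)|$, and $\mathrm{tw}(G)$ is the least width of a tree decomposition of $G$ (one is not subtracted). **Cospans of graphs.** Let $\mathcal C$ be the following monoidal category. Its objects are finite sets. A morphism $X\to Y$ is an isomorphism class of cospans $X\to G\leftarrow Y$, i.e. of a graph $G$ (the apex) with two functions $X\to V(G)$ and $Y\to V(G)$. Composition is by pushout: the apex of the composite of $X\to G\leftarrow Y$ and $Y\to H\leftarrow Z$ has as vertices the disjoint union $V(G)+V(H)$ with the two images of every $y\in Y$ identified, and as edges $E(G)+E(H)$. The monoidal product $\otimes$ is disjoint union, with unit $\emptyset$. **Monoidal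 tree width.** The monoidal right tree decompositions of a morphism $f\colon A\to B$ of $\mathcal C$ and their widths are defined recursively, where equalities of morphisms are understood, as usual, up to the coherence isomorphisms (associators and unitors) of $\otimes$: (i) $(f)$ is one, of width the number of vertices of the apex of $f$; (ii) if $f=f_1\otimes f_2$ and $d_1,d_2$ are right tree decompositions of $f_1,f_2$, then $(d_1,\otimes,d_2)$ is one, of width $\max\{\mathrm{wd}(d_1),\mathrm{wd}(d_2)\}$; (iii) if $f=g\,;f_1$ with $g\colon A\to X$, $f_1\colon X\to B$, and $d_1$ is a right tree decomposition of $f_1$, then $(g,;_X,d_1)$ is one, of width $\max\{w,|X|,\mathrm{wd}(d_1)\}$, where $w$ is the number of vertices of the apex of $g$. Left tree decompositions are defined in the same way, except that in (iii) $f=f_1\,;g$ with the recursion on the left factor $f_1$. The monoidal right (left) tree width $\mathrm{mtwd}^r(f)$ ($\mathrm{mtwd}^l(f)$) is the least width of a right (left) tree decomposition of $f$. **Theorem.** Let $G$ be a graph and let $g=(\emptyset\to G\leftarrow\emptyset)\colon\emptyset\to\emptyset$ be the corresponding morphism of $\mathcal C$. Then $\mathrm{mtwd}^l(g)=\mathrm{mtwd}^r(g)=:\mathrm{mtwd}(g)$,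 and $$\mathrm{tw}(G)\le \mathrm{mtwd}(g)\le 2\cdot \mathrm{tw}(G).$$ -/

import Mathlib

open CategoryTheory MonoidalCategory

universe u

/-! ## Monoidal tree decompositions and monoidal tree width -/

namespace MonoidalWidth

universe v w

variable {C : Type w} [Category.{v} C] [MonoidalCategory C]

/-- The structural (coherence) morphisms of a monoidal category: those built from identities,
associators and unitors by composition and monoidal product. In a strict monoidal category they
are all identities. -/
inductive IsStructural : ∀ {A B : C}, (A ⟶ B) → Prop
  | id (A : C) : IsStructural (𝟙 A)
  | comp {A B D : C} {f : A ⟶ B} {g : B ⟶ D} :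
      IsStructural f → IsStructural g → IsStructural (f ≫ g)
  | tensor {A B A' B' : C} {f : A ⟶ B} {g : A' ⟶ B'} :
      IsStructural f → IsStructural g → IsStructural (f ⊗ₘ g)
  | associator_hom (A B D : C) : IsStructural (α_ A B D).hom
  | associator_inv (A B D : C) : IsStructural (α_ A B D).inv
  | leftUnitor_hom (A : C) : IsStructural (λ_ A).hom
  | leftUnitor_inv (A : C) : IsStructural (λ_ A).inv
  | rightUnitor_hom (A : C) : IsStructural (ρ_ A).hom
  | rightUnitor_inv (A : C) : IsStructural (ρ_ A).inv

/-- A weight function for a monoidal category with a set of atomic morphisms: `obj X` is the weight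
of a sequential composition along `X`, `hom g` the weight of the atom `g`. A monoidal product costs
nothing, so its weight does not appear. (`obj_unit` follows from `obj_tensor` in the strict
case.) -/
structure WeightFunction (atoms : MorphismProperty C) where
  obj : C → ℕ
  hom : ∀ {A B : C} (g : A ⟶ B), atoms g → ℕ
  obj_tensor : ∀ X Y : C, obj (X ⊗ Y) = obj X + obj Y
  obj_unit : obj (𝟙_ C) = 0

/-- Monoidal right tree decompositions of a morphism. A decomposition is a leaf labelled by an atom,
a monoidal product of two decompositions, or a composition of an atom with a decomposition on its
right. The constructor `coherence` says that the equation `f = f₁ ⊗ f₂` is read, as is usual with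
string diagrams, up to the structural isomorphisms (which are identities in the strict case). -/
inductive RightTreeDec (atoms : MorphismProperty C) : ∀ {A B : C}, (A ⟶ B) → Type (max v w)
  | leaf {A B : C} (f : A ⟶ B) (hf : atoms f) : RightTreeDec atoms f
  | tensor {A₁ B₁ A₂ B₂ : C} {f₁ : A₁ ⟶ B₁} {f₂ : A₂ ⟶ B₂}
      (d₁ : RightTreeDec atoms f₁) (d₂ : RightTreeDec atoms f₂) : RightTreeDec atoms (f₁ ⊗ₘ f₂)
  | comp {A X B : C} (g : A ⟶ X) (hg : atoms g) {f : X ⟶ B} (d : RightTreeDec atoms f) :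
      RightTreeDec atoms (g ≫ f)
  | coherence {A' A B B' : C} {a : A' ⟶ A} (ha : IsStructural a) {f : A ⟶ B}
      (d : RightTreeDec atoms f) {b : B ⟶ B'} (hb : IsStructural b) :
      RightTreeDec atoms (a ≫ f ≫ b)

/-- Monoidal left tree decompositions: recursion is allowed on the left of the composition. -/
inductive LeftTreeDec (atoms : MorphismProperty C) : ∀ {A B : C}, (A ⟶ B) → Type (max v w)
  | leaf {A B : C} (f : A ⟶ B) (hf : atoms f) : LeftTreeDec atoms f
  | tensor {A₁ B₁ A₂ B₂ : C} {f₁ : A₁ ⟶ B₁} {f₂ : A₂ ⟶ B₂}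
      (d₁ : LeftTreeDec atoms f₁) (d₂ : LeftTreeDec atoms f₂) : LeftTreeDec atoms (f₁ ⊗ₘ f₂)
  | comp {A X B : C} {f : A ⟶ X} (d : LeftTreeDec atoms f) (g : X ⟶ B) (hg : atoms g) :
      LeftTreeDec atoms (f ≫ g)
  | coherence {A' A B B' : C} {a : A' ⟶ A} (ha : IsStructural a) {f : A ⟶ B}
      (d : LeftTreeDec atoms f) {b : B ⟶ B'} (hb : IsStructural b) :
      LeftTreeDec atoms (a ≫ f ≫ b)

variable {atoms : MorphismProperty C}

/-- The width of a right tree decomposition: the weight of its most expensive node. -/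
def RightTreeDec.width (ω : WeightFunction atoms) :
    ∀ {A B : C} {f : A ⟶ B}, RightTreeDec atoms f → ℕ
  | _, _, _, .leaf f hf => ω.hom f hf
  | _, _, _, .tensor d₁ d₂ => max (d₁.width ω) (d₂.width ω)
  | _, _, _, .comp (X := X) g hg d => max (ω.hom g hg) (max (ω.obj X) (d.width ω))
  | _, _, _, .coherence _ d _ => d.width ω

/-- The width of a left tree decomposition. -/
def LeftTreeDec.width (ω : WeightFunction atoms) :
    ∀ {A B : C} {f : A ⟶ B}, LeftTreeDec atoms f → ℕ
  | _, _, _, .leaf f hf => ω.hom f hf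
  | _, _, _, .tensor d₁ d₂ => max (d₁.width ω) (d₂.width ω)
  | _, _, _, .comp (X := X) d g hg => max (d.width ω) (max (ω.obj X) (ω.hom g hg))
  | _, _, _, .coherence _ d _ => d.width ω

/-- Monoidal right tree width: the least width of a right tree decomposition. (The infimum is an
attained minimum as soon as a decomposition exists, in particular if all morphisms are atomic.) -/
noncomputable def rightTreeWidth (ω : WeightFunction atoms) {A B : C} (f : A ⟶ B) : ℕ :=
  sInf (Set.range fun d : RightTreeDec atoms f => d.width ω)

/-- Monoidal left tree width: the least width of a left tree decomposition. -/
noncomputable def leftTreeWidth (ω : WeightFunction atoms) {A B : C} (f : A ⟶ B) : ℕ :=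
  sInf (Set.range fun d : LeftTreeDec atoms f => d.width ω)

end MonoidalWidth

/-! ## Graphs and tree width -/

/-- A finite undirected graph; loops and parallel edges are allowed. `Sym2 V` is the set of
subsets of `V` with one or two elements. -/
structure UGraph where
  V : Type u
  E : Type u
  [finiteV : Finite V]
  [finiteE : Finite E]
  ends : E → Sym2 V

attribute [instance] UGraph.finiteV UGraph.finiteE

namespace UGraph

/-- A tree decomposition `(Y, t)` of a graph: a finite tree `Y` with a bag `t i` of vertices for
every node `i`, such that every vertex lies in a bag, every edge has its endpoints in a common bag,
and `t i ∩ t k ⊆ t j` whenever `j` lies on the path of `Y` from `i` to `k`. -/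
structure TreeDecomposition (G : UGraph.{u}) where
  node : Type
  [fintypeNode : Fintype node]
  tree : SimpleGraph node
  isTree : tree.IsTree
  bag : node → Set G.V
  vertex_mem : ⋃ i, bag i = Set.univ
  edge_subset : ∀ e : G.E, ∃ i, ∀ v ∈ G.ends e, v ∈ bag i
  inter_subset : ∀ (i k : node) (p : tree.Walk i k), p.IsPath →
    ∀ j ∈ p.support, bag i ∩ bag k ⊆ bag j

attribute [instance] TreeDecomposition.fintypeNode

/-- The width of a tree decomposition: the size of the largest bag. -/
noncomputable def TreeDecomposition.width {G : UGraph.{u}} (T : G.TreeDecomposition) : ℕ :=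
  Finset.univ.sup fun i => (T.bag i).ncard

/-- Tree width, with the convention of maximal bag size (one is not subtracted). A graph always has
the decomposition with a single bag, so that this is an attained minimum. -/
noncomputable def treeWidth (G : UGraph.{u}) : ℕ :=
  sInf (Set.range fun T : G.TreeDecomposition => T.width)

/-- The discrete graph on a finite set. -/
abbrev discrete (X : Type u) [Finite X] : UGraph.{u} where
  V := X
  E := PEmpty
  ends := PEmpty.elim

/-- Disjoint union (coproduct) of graphs. -/
abbrev sum (G H : UGraph.{u}) : UGraph.{u} where
  V := G.V ⊕ H.V
  E := G.E ⊕ H.E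
  ends := Sum.elim (fun e => (G.ends e).map Sum.inl) (fun e => (H.ends e).map Sum.inr)

/-- The relation identifying `f s` with `g s` in a disjoint union. -/
inductive GlueRel {S A B : Type u} (f : S → A) (g : S → B) : A ⊕ B → A ⊕ B → Prop
  | mk (s : S) : GlueRel f g (Sum.inl (f s)) (Sum.inr (g s))

/-- The pushout of two functions with common domain: the disjoint union modulo the equivalence
relation generated by `f s ∼ g s`. -/
def Glue {S A B : Type u} (f : S → A) (g : S → B) : Type u := Quot (GlueRel f g)

namespace Glue

variable {S A B : Type u} {f : S → A} {g : S → B}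

instance [Finite A] [Finite B] : Finite (Glue f g) := inferInstanceAs (Finite (Quot _))

def inl (a : A) : Glue f g := Quot.mk _ (Sum.inl a)

def inr (b : B) : Glue f g := Quot.mk _ (Sum.inr b)

theorem condition (s : S) : (inl (f s) : Glue f g) = inr (g s) := Quot.sound (.mk s)

/-- The map out of a pushout induced by a compatible pair of maps. -/
def desc {D : Type*} (h : A → D) (k : B → D) (w : ∀ s, h (f s) = k (g s)) : Glue f g → D :=
  Quot.lift (Sum.elim h k) (by rintro _ _ ⟨s⟩; exact w s)

@[simp]
theorem desc_inl {D : Type*} (h : A → D) (k : B → D) (w : ∀ s, h (f s) = k (g s)) (a : A) :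
    desc h k w (inl a : Glue f g) = h a := rfl

@[simp]
theorem desc_inr {D : Type*} (h : A → D) (k : B → D) (w : ∀ s, h (f s) = k (g s)) (b : B) :
    desc h k w (inr b : Glue f g) = k b := rfl

theorem ind {P : Glue f g → Prop} (hl : ∀ a, P (inl a)) (hr : ∀ b, P (inr b)) (x) : P x := by
  obtain ⟨a | b⟩ := x
  exacts [hl a, hr b]

end Glue

/-- The pushout of two graphs along maps from a discrete graph `S` into their vertices: common
sources are identified, edges are kept. -/
abbrev glue {S : Type u} (G H : UGraph.{u}) (f : S → G.V) (g : S → H.V) : UGraph.{u} where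
  V := Glue f g
  E := G.E ⊕ H.E
  ends := Sum.elim (fun e => (G.ends e).map Glue.inl) (fun e => (H.ends e).map Glue.inr)

end UGraph

/-! ## The monoidal category of cospans of graphs with discrete feet -/

/-- A cospan of graphs `X → G ← Y` between discrete graphs; morphisms out of a discrete graph
are functions into the set of vertices. -/
structure GraphCospan (X Y : Type u) where
  apex : UGraph.{u}
  left : X → apex.V
  right : Y → apex.V

namespace GraphCospan

open UGraph

variable {X Y Z W X' Y' Z' X'' Y'' : Type u}

/-- Isomorphism of cospans: an isomorphism of the apices (bijections on vertices and on edges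
compatible with endpoints) that commutes with the legs. -/
structure Iso (g h : GraphCospan X Y) where
  vert : g.apex.V ≃ h.apex.V
  edge : g.apex.E ≃ h.apex.E
  ends_edge : ∀ e, h.apex.ends (edge e) = (g.apex.ends e).map vert
  vert_left : ∀ x, vert (g.left x) = h.left x
  vert_right : ∀ y, vert (g.right y) = h.right y

namespace Iso

def refl (g : GraphCospan X Y) : Iso g g where
  vert := .refl _
  edge := .refl _
  ends_edge e := by simp
  vert_left _ := rfl
  vert_right _ := rfl

def symm {g h : GraphCospan X Y} (i : Iso g h) : Iso h g where
  vert := i.vert.symm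
  edge := i.edge.symm
  ends_edge e := by
    have := i.ends_edge (i.edge.symm e)
    rw [Equiv.apply_symm_apply] at this
    rw [this, Sym2.map_map]
    simp
  vert_left x := by rw [← i.vert_left, Equiv.symm_apply_apply]
  vert_right y := by rw [← i.vert_right, Equiv.symm_apply_apply]

def trans {g h k : GraphCospan X Y} (i : Iso g h) (j : Iso h k) : Iso g k where
  vert := i.vert.trans j.vert
  edge := i.edge.trans j.edge
  ends_edge e := by simp [j.ends_edge, i.ends_edge, Sym2.map_map]
  vert_left x := by simp [i.vert_left, j.vert_left]
  vert_right y := by simp [i.vert_right, j.vert_right]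

end Iso

instance setoid (X Y : Type u) : Setoid (GraphCospan X Y) where
  r g h := Nonempty (Iso g h)
  iseqv := ⟨fun g => ⟨.refl g⟩, fun ⟨i⟩ => ⟨i.symm⟩, fun ⟨i⟩ ⟨j⟩ => ⟨i.trans j⟩⟩

/-- The cospan `X → Y ← Y` with discrete apex given by a function and an identity. -/
abbrev ofFun [Finite Y] (f : X → Y) : GraphCospan X Y := ⟨discrete Y, f, id⟩

/-- Composition by pushout. -/
abbrev comp (g : GraphCospan X Y) (h : GraphCospan Y Z) : GraphCospan X Z where
  apex := glue g.apex h.apex g.right h.left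
  left x := Glue.inl (g.left x)
  right z := Glue.inr (h.right z)

/-- Monoidal product by disjoint union. -/
abbrev tensor (g : GraphCospan X Y) (h : GraphCospan X' Y') : GraphCospan (X ⊕ X') (Y ⊕ Y') where
  apex := g.apex.sum h.apex
  left := Sum.map g.left h.left
  right := Sum.map g.right h.right

/-- Reindexing of both feet. -/
abbrev reindex (a : X' → X) (b : Y' → Y) (g : GraphCospan X Y) : GraphCospan X' Y' :=
  ⟨g.apex, g.left ∘ a, g.right ∘ b⟩

def compCongr {g g' : GraphCospan X Y} {h h' : GraphCospan Y Z} (i : Iso g g') (j : Iso h h') :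
    Iso (g.comp h) (g'.comp h') where
  vert :=
    { toFun := Glue.desc (fun a => Glue.inl (i.vert a)) (fun b => Glue.inr (j.vert b))
        (fun s => by rw [i.vert_right, j.vert_left, Glue.condition])
      invFun := Glue.desc (fun a => Glue.inl (i.vert.symm a)) (fun b => Glue.inr (j.vert.symm b))
        (fun s => by
          rw [← i.vert_right, ← j.vert_left, Equiv.symm_apply_apply, Equiv.symm_apply_apply,
            Glue.condition])
      left_inv := Glue.ind (fun a => by simp) (fun b => by simp)
      right_inv := Glue.ind (fun a => by simp) (fun b => by simp) }
  edge := Equiv.sumCongr i.edge j.edge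
  ends_edge := by
    rintro (e | e)
    · simp [comp, glue, i.ends_edge, Sym2.map_map, Function.comp_def]
    · simp [comp, glue, j.ends_edge, Sym2.map_map, Function.comp_def]
  vert_left x := by simp [comp, i.vert_left]
  vert_right x := by simp [comp, j.vert_right]

def tensorCongr {g g' : GraphCospan X Y} {h h' : GraphCospan X' Y'} (i : Iso g g')
    (j : Iso h h') : Iso (g.tensor h) (g'.tensor h') where
  vert := Equiv.sumCongr i.vert j.vert
  edge := Equiv.sumCongr i.edge j.edge
  ends_edge := by
    rintro (e | e)
    · simp [tensor, UGraph.sum, i.ends_edge, Sym2.map_map, Function.comp_def]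
    · simp [tensor, UGraph.sum, j.ends_edge, Sym2.map_map, Function.comp_def]
  vert_left := by rintro (x | x) <;> simp [tensor, i.vert_left, j.vert_left]
  vert_right := by rintro (x | x) <;> simp [tensor, i.vert_right, j.vert_right]

def compAssoc (g : GraphCospan X Y) (h : GraphCospan Y Z) (k : GraphCospan Z W) :
    Iso ((g.comp h).comp k) (g.comp (h.comp k)) where
  vert :=
    { toFun := Glue.desc
        (Glue.desc (fun a => Glue.inl a) (fun b => Glue.inr (Glue.inl b)) Glue.condition)
        (fun c => Glue.inr (Glue.inr c)) (fun s => congrArg Glue.inr (Glue.condition s))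
      invFun := Glue.desc (fun a => Glue.inl (Glue.inl a))
        (Glue.desc (fun b => Glue.inl (Glue.inr b)) (fun c => Glue.inr c) Glue.condition)
        (fun s => congrArg Glue.inl (Glue.condition s))
      left_inv := Glue.ind (Glue.ind (fun _ => rfl) (fun _ => rfl)) (fun _ => rfl)
      right_inv := Glue.ind (fun _ => rfl) (Glue.ind (fun _ => rfl) (fun _ => rfl)) }
  edge := Equiv.sumAssoc _ _ _
  ends_edge := by
    rintro ((e | e) | e) <;> simp [comp, glue, Sym2.map_map] <;> rfl
  vert_left x := rfl
  vert_right x := rfl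

def ofFunComp [Finite Y] (f : X → Y) (g : GraphCospan Y Z) :
    Iso ((ofFun f).comp g) (g.reindex f id) where
  vert :=
    { toFun := Glue.desc g.left id (fun _ => rfl)
      invFun := Glue.inr
      left_inv := Glue.ind (fun a => (Glue.condition a).symm) (fun _ => rfl)
      right_inv _ := rfl }
  edge := Equiv.emptySum PEmpty g.apex.E
  ends_edge := by
    rintro (e | e)
    · exact e.elim
    · change _ = Sym2.map _ (Sym2.map _ _)
      rw [Sym2.map_map]
      exact (congrFun Sym2.map_id _).symm
  vert_left x := rfl
  vert_right x := rfl

def compOfEquiv [Finite Z] (g : GraphCospan X Y) (f : Y ≃ Z) :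
    Iso (g.comp (ofFun f)) (g.reindex id f.symm) where
  vert :=
    { toFun := Glue.desc id (fun z => g.right (f.symm z)) (fun y => by simp)
      invFun := Glue.inl
      left_inv := Glue.ind (fun _ => rfl) (fun z => by
        have := Glue.condition (f := g.right) (g := (ofFun f).left) (f.symm z)
        simpa [ofFun] using this)
      right_inv _ := rfl }
  edge := Equiv.sumEmpty g.apex.E PEmpty
  ends_edge := by
    rintro (e | e)
    · change _ = Sym2.map _ (Sym2.map _ _)
      rw [Sym2.map_map]
      exact (congrFun Sym2.map_id _).symm
    · exact e.elim
  vert_left x := rfl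
  vert_right x := rfl

def tensorOfFun [Finite Y] [Finite Y'] (f : X → Y) (f' : X' → Y') :
    Iso ((ofFun f).tensor (ofFun f')) (ofFun (Sum.map f f')) where
  vert := .refl _
  edge := Equiv.emptySum PEmpty PEmpty
  ends_edge := by rintro (e | e) <;> exact e.elim
  vert_left x := rfl
  vert_right := by rintro (x | x) <;> rfl

def interchange (g : GraphCospan X Y) (h : GraphCospan Y Z) (g' : GraphCospan X' Y')
    (h' : GraphCospan Y' Z') :
    Iso ((g.tensor g').comp (h.tensor h')) ((g.comp h).tensor (g'.comp h')) where
  vert :=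
    { toFun := Glue.desc (Sum.map Glue.inl Glue.inl) (Sum.map Glue.inr Glue.inr) (by
        rintro (s | s)
        · exact congrArg Sum.inl (Glue.condition s)
        · exact congrArg Sum.inr (Glue.condition s))
      invFun := Sum.elim
        (Glue.desc (fun a => Glue.inl (Sum.inl a)) (fun a => Glue.inr (Sum.inl a))
          (fun s => Glue.condition (f := Sum.map g.right g'.right) (Sum.inl s)))
        (Glue.desc (fun a => Glue.inl (Sum.inr a)) (fun a => Glue.inr (Sum.inr a))
          (fun s => Glue.condition (f := Sum.map g.right g'.right) (Sum.inr s)))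
      left_inv := Glue.ind (by rintro (a | a) <;> rfl) (by rintro (a | a) <;> rfl)
      right_inv := by
        rintro (x | x)
        · obtain ⟨a | a⟩ := x <;> rfl
        · obtain ⟨a | a⟩ := x <;> rfl }
  edge := Equiv.sumSumSumComm _ _ _ _
  ends_edge := by
    rintro ((e | e) | (e | e)) <;>
      simp [comp, glue, tensor, UGraph.sum, Sym2.map_map, Function.comp_def]
  vert_left := by rintro (x | x) <;> rfl
  vert_right := by rintro (x | x) <;> rfl

def tensorAssoc (g : GraphCospan X Y) (g' : GraphCospan X' Y') (g'' : GraphCospan X'' Y'') :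
    Iso (((g.tensor g').tensor g'').reindex id (Equiv.sumAssoc _ _ _).symm)
      ((g.tensor (g'.tensor g'')).reindex (Equiv.sumAssoc _ _ _) id) where
  vert := Equiv.sumAssoc _ _ _
  edge := Equiv.sumAssoc _ _ _
  ends_edge := by
    rintro ((e | e) | e) <;>
      simp [reindex, tensor, UGraph.sum, Sym2.map_map, Function.comp_def]
  vert_left := by rintro ((x | x) | x) <;> rfl
  vert_right := by rintro (x | (x | x)) <;> rfl

def emptyTensor (g : GraphCospan X Y) :
    Iso (((ofFun (id : PEmpty.{u+1} → PEmpty.{u+1})).tensor g).reindex id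
      (Equiv.emptySum PEmpty _).symm) (g.reindex (Equiv.emptySum PEmpty _) id) where
  vert := Equiv.emptySum PEmpty _
  edge := Equiv.emptySum PEmpty _
  ends_edge := by
    rintro (e | e)
    · exact e.elim
    · simp [reindex, tensor, UGraph.sum, Sym2.map_map, Function.comp_def]
  vert_left := by
    rintro (x | x)
    · exact x.elim
    · rfl
  vert_right _ := rfl

def tensorEmpty (g : GraphCospan X Y) :
    Iso ((g.tensor (ofFun (id : PEmpty.{u+1} → PEmpty.{u+1}))).reindex id
      (Equiv.sumEmpty _ PEmpty).symm) (g.reindex (Equiv.sumEmpty _ PEmpty) id) where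
  vert := Equiv.sumEmpty _ PEmpty
  edge := Equiv.sumEmpty _ PEmpty
  ends_edge := by
    rintro (e | e)
    · simp [reindex, tensor, UGraph.sum, Sym2.map_map, Function.comp_def]
    · exact e.elim
  vert_left := by
    rintro (x | x)
    · rfl
    · exact x.elim
  vert_right _ := rfl

end GraphCospan

/-- Objects of the category of cospans of graphs restricted to discrete feet: finite sets. -/
structure CospanGraph where
  carrier : Type u
  [finite : Finite carrier]

attribute [instance] CospanGraph.finite

namespace CospanGraph

/-- Morphisms are isomorphism classes of cospans. -/
abbrev Hom (X Y : CospanGraph.{u}) : Type (u + 1) :=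
  Quotient (GraphCospan.setoid X.carrier Y.carrier)

instance : Category CospanGraph.{u} where
  Hom := Hom
  id X := Quotient.mk _ (GraphCospan.ofFun id)
  comp := Quotient.map₂ GraphCospan.comp fun _ _ ⟨i⟩ _ _ ⟨j⟩ => ⟨GraphCospan.compCongr i j⟩
  id_comp := by
    rintro _ _ ⟨g⟩
    exact Quotient.sound ⟨GraphCospan.ofFunComp id g⟩
  comp_id := by
    rintro _ _ ⟨g⟩
    exact Quotient.sound ⟨GraphCospan.compOfEquiv g (Equiv.refl _)⟩
  assoc := by
    rintro _ _ _ _ ⟨g⟩ ⟨h⟩ ⟨k⟩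
    exact Quotient.sound ⟨GraphCospan.compAssoc g h k⟩

/-- The morphism given by a cospan. -/
def ofCospan {X Y : CospanGraph.{u}} (g : GraphCospan X.carrier Y.carrier) : X ⟶ Y := Quotient.mk _ g

theorem ofCospan_eq {X Y : CospanGraph.{u}} {g h : GraphCospan X.carrier Y.carrier}
    (i : GraphCospan.Iso g h) : ofCospan g = ofCospan h := Quotient.sound ⟨i⟩

theorem ofCospan_surjective {X Y : CospanGraph.{u}} (f : X ⟶ Y) : ∃ g, f = ofCospan g := by
  obtain ⟨g⟩ := f
  exact ⟨g, rfl⟩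

theorem ofFun_comp {X Y Z : CospanGraph.{u}} (f : X.carrier → Y.carrier)
    (g : GraphCospan Y.carrier Z.carrier) :
    (ofCospan (GraphCospan.ofFun f) : X ⟶ Y) ≫ (ofCospan g : Y ⟶ Z) = ofCospan (g.reindex f id) :=
  ofCospan_eq (GraphCospan.ofFunComp f g)

theorem comp_ofEquiv {X Y Z : CospanGraph.{u}} (g : GraphCospan X.carrier Y.carrier)
    (f : Y.carrier ≃ Z.carrier) :
    (ofCospan g : X ⟶ Y) ≫ (ofCospan (GraphCospan.ofFun f) : Y ⟶ Z) = ofCospan (g.reindex id f.symm) :=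
  ofCospan_eq (GraphCospan.compOfEquiv g f)

theorem ofFun_comp_ofFun {X Y Z : CospanGraph.{u}} (f : X.carrier → Y.carrier)
    (g : Y.carrier → Z.carrier) :
    (ofCospan (GraphCospan.ofFun f) : X ⟶ Y) ≫ (ofCospan (GraphCospan.ofFun g) : Y ⟶ Z) =
      ofCospan (GraphCospan.ofFun (g ∘ f)) :=
  ofFun_comp f (GraphCospan.ofFun g)

/-- A bijection of finite sets as an isomorphism of cospans. -/
def ofEquiv {X Y : CospanGraph.{u}} (e : X.carrier ≃ Y.carrier) : X ≅ Y where
  hom := ofCospan (GraphCospan.ofFun e)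
  inv := ofCospan (GraphCospan.ofFun e.symm)
  hom_inv_id := by rw [ofFun_comp_ofFun, Equiv.symm_comp_self]; rfl
  inv_hom_id := by rw [ofFun_comp_ofFun, Equiv.self_comp_symm]; rfl

/-- The monoidal product of morphisms. -/
def tensorMap {X Y X' Y' : CospanGraph.{u}} (f : Hom X Y) (g : Hom X' Y') :
    Hom ⟨X.carrier ⊕ X'.carrier⟩ ⟨Y.carrier ⊕ Y'.carrier⟩ :=
  Quotient.map₂ (sa := GraphCospan.setoid _ _) (sb := GraphCospan.setoid _ _)
    (sc := GraphCospan.setoid _ _) GraphCospan.tensor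
    (fun _ _ ⟨i⟩ _ _ ⟨j⟩ => ⟨GraphCospan.tensorCongr i j⟩) f g

/-- The monoidal structure: disjoint union, with the empty set as unit and the evident bijections as
structural isomorphisms. -/
instance : MonoidalCategoryStruct CospanGraph.{u} where
  tensorObj X Y := ⟨X.carrier ⊕ Y.carrier⟩
  tensorHom f g := tensorMap f g
  whiskerLeft X _ _ f := tensorMap (𝟙 X) f
  whiskerRight f Y := tensorMap f (𝟙 Y)
  tensorUnit := ⟨PEmpty⟩
  associator X Y Z := ofEquiv (Equiv.sumAssoc X.carrier Y.carrier Z.carrier)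
  leftUnitor X := ofEquiv (Equiv.emptySum PEmpty X.carrier)
  rightUnitor X := ofEquiv (Equiv.sumEmpty X.carrier PEmpty)

theorem ofFun_tensor {X Y X' Y' : CospanGraph.{u}} (f : X.carrier → Y.carrier)
    (f' : X'.carrier → Y'.carrier) :
    (ofCospan (GraphCospan.ofFun f) : X ⟶ Y) ⊗ₘ (ofCospan (GraphCospan.ofFun f') : X' ⟶ Y') =
      (ofCospan (GraphCospan.ofFun (Sum.map f f')) :
        MonoidalCategoryStruct.tensorObj X X' ⟶ MonoidalCategoryStruct.tensorObj Y Y') :=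
  ofCospan_eq (GraphCospan.tensorOfFun f f')

instance : MonoidalCategory CospanGraph.{u} := MonoidalCategory.ofTensorHom
  (id_tensorHom_id := fun X Y => (ofFun_tensor _ _).trans (by rw [Sum.map_id_id]; rfl))
  (id_tensorHom := fun _ _ _ _ => rfl)
  (tensorHom_id := fun _ _ => rfl)
  (tensorHom_comp_tensorHom := by
    rintro _ _ _ _ _ _ ⟨g⟩ ⟨g'⟩ ⟨h⟩ ⟨h'⟩
    exact ofCospan_eq (GraphCospan.interchange g h g' h'))
  (associator_naturality := by
    rintro X₁ X₂ X₃ Y₁ Y₂ Y₃ ⟨f₁⟩ ⟨f₂⟩ ⟨f₃⟩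
    exact (comp_ofEquiv (X := ⟨_⟩) (Y := ⟨_⟩) (Z := ⟨_⟩) _ (Equiv.sumAssoc _ _ _)).trans
      ((ofCospan_eq (GraphCospan.tensorAssoc f₁ f₂ f₃)).trans (ofFun_comp _ _).symm))
  (leftUnitor_naturality := by
    rintro X Y ⟨f⟩
    exact (comp_ofEquiv (X := ⟨_⟩) (Y := ⟨_⟩) (Z := ⟨_⟩) _ (Equiv.emptySum PEmpty _)).trans
      ((ofCospan_eq (GraphCospan.emptyTensor f)).trans (ofFun_comp _ _).symm))
  (rightUnitor_naturality := by
    rintro X Y ⟨f⟩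
    exact (comp_ofEquiv (X := ⟨_⟩) (Y := ⟨_⟩) (Z := ⟨_⟩) _ (Equiv.sumEmpty _ PEmpty)).trans
      ((ofCospan_eq (GraphCospan.tensorEmpty f)).trans (ofFun_comp _ _).symm))
  (pentagon := by
    intro W X Y Z
    change ((ofCospan (GraphCospan.ofFun _)) ⊗ₘ (ofCospan (GraphCospan.ofFun _))) ≫ ofCospan (GraphCospan.ofFun _) ≫
      ((ofCospan (GraphCospan.ofFun _)) ⊗ₘ (ofCospan (GraphCospan.ofFun _))) =
      ofCospan (GraphCospan.ofFun _) ≫ ofCospan (GraphCospan.ofFun _)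
    rw [ofFun_tensor, ofFun_tensor, ofFun_comp_ofFun, ofFun_comp_ofFun, ofFun_comp_ofFun]
    congr 2
    funext x
    rcases x with ((x | x) | x) | x <;> rfl)
  (triangle := by
    intro X Y
    change ofCospan (GraphCospan.ofFun _) ≫ ((ofCospan (GraphCospan.ofFun _)) ⊗ₘ (ofCospan (GraphCospan.ofFun _))) =
      ((ofCospan (GraphCospan.ofFun _)) ⊗ₘ (ofCospan (GraphCospan.ofFun _)))
    rw [ofFun_tensor, ofFun_tensor, ofFun_comp_ofFun]
    congr 2
    funext x
    rcases x with (x | x) | x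
    · rfl
    · exact x.elim
    · rfl)

/-- The number of vertices of the apex of a morphism. -/
noncomputable def apexCard {X Y : CospanGraph.{u}} (f : X ⟶ Y) : ℕ :=
  Quotient.lift (s := GraphCospan.setoid _ _) (fun g : GraphCospan X.carrier Y.carrier => Nat.card g.apex.V)
    (fun _ _ ⟨i⟩ => Nat.card_congr i.vert) f

/-- All morphisms are atomic; a composition along `X` costs the cardinality of `X`, an atom costs
the number of vertices of its apex. -/
noncomputable def weight :
    MonoidalWidth.WeightFunction (⊤ : MorphismProperty CospanGraph.{u}) where
  obj X := Nat.card X.carrier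
  hom g _ := apexCard g
  obj_tensor _ _ := Nat.card_sum
  obj_unit := Nat.card_of_isEmpty (α := PEmpty)

/-- The morphism `∅ → G ← ∅` of a graph. -/
def ofGraph (G : UGraph.{u}) : 𝟙_ CospanGraph.{u} ⟶ 𝟙_ CospanGraph.{u} :=
  ofCospan ⟨G, PEmpty.elim, PEmpty.elim⟩

end CospanGraph

/-! Reversing a cospan turns right decompositions into left ones of the same width and fixes
`ofGraph G`. Hence the two monoidal widths agree, and only right decompositions need to be compared
with tree decompositions.

Both comparisons go through `IsRootedDec`, where decompositions are joined at their roots and may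
overlap only inside both root bags. By `IsRootedDec.exists_tree` and
`TreeDecomposition.exists_isRootedDec` this is as good as an ordinary tree decomposition; the set of
bags may forget multiplicities, since only unions and sizes of bags matter.

Lower bound (`exists_hasRootedDec`): by induction on a right decomposition, each morphism gets a
rooted decomposition whose root bag contains its left foot. An atom is one bag. For `g ≫ f` the apex
of `g` becomes the new root, which meets the rest only in the common foot. For a product the left
foot itself becomes a new root to which both factors are joined. It is small enough because the foot
is empty at the start, is paid for by each composition, and shrinks in the factors of a product.
Gluing on the left may collapse vertices of the left foot, so the induction runs over maps into `G`
that identify nothing else (`IsAlmostEmbedding`).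

Upper bound (`exists_rightTreeDec_of_isRootedDec`): a join with root bags `S` and `S'` is the
discrete graph on `S`, with right foot `S ⊕ (S ∩ S')`, followed by the product of the two parts.
This cut has size at most `2 * k`, which is the source of the factor two. -/

namespace SimpleGraph

/-! ### Trees and walks -/

variable {N N' : Type*} {T : SimpleGraph N} {T' : SimpleGraph N'}

/-- Joining two finite trees by an edge gives a tree. -/
theorem IsTree.sum_sup_edge [Finite N] [Finite N'] (hT : T.IsTree) (hT' : T'.IsTree)
    (r : N) (r' : N') : ((T ⊕g T') ⊔ edge (Sum.inl r) (Sum.inr r')).IsTree := by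
  -- For finite graphs, being a tree means being connected with one more vertex than edges; the new
  -- edge makes up for the second surplus vertex.
  rw [isTree_iff_connected_and_card] at hT hT' ⊢
  refine ⟨hT.1.sum_sup_edge hT'.1, ?_⟩
  have hne : (Sum.inl r : N ⊕ N') ≠ Sum.inr r' := Sum.inl_ne_inr
  have hnot : s(Sum.inl r, Sum.inr r') ∉ (T ⊕g T').edgeSet := by simp
  rw [Nat.card_coe_set_eq, edgeSet_sup, edgeSet_edge_of_ne hne, Set.union_singleton,
    Set.ncard_insert_of_notMem hnot, ← Nat.card_coe_set_eq,
    Nat.card_congr edgeSetSumEquiv, Nat.card_sum, Nat.card_sum, ← hT.2, ← hT'.2]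
  omega

/-- In an acyclic graph a path is contained in every walk with the same ends. -/
theorem IsAcyclic.support_subset (hT : T.IsAcyclic) {i k : N} {p : T.Walk i k} (hp : p.IsPath)
    (q : T.Walk i k) : p.support ⊆ q.support := by
  classical
  have h : (⟨p, hp⟩ : T.Path i k) = q.toPath := (hT.subsingleton_path i k).elim _ _
  have h' : p = (q.toPath : T.Walk i k) := congrArg Subtype.val h
  rw [h']
  exact q.support_toPath_subset_support

theorem Walk.exists_map_support (f : T →g T') {P : N' → Prop} {i j : N} (p : T.Walk i j)
    (h : ∀ l ∈ p.support, P (f l)) : ∃ q : T'.Walk (f i) (f j), ∀ l ∈ q.support, P l := by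
  refine ⟨p.map f, fun l hl => ?_⟩
  rw [Walk.support_map] at hl
  obtain ⟨m, hm, rfl⟩ := List.mem_map.1 hl
  exact h m hm

end SimpleGraph

/-! ### Recursively presented tree decompositions -/

namespace UGraph

/-- Recursively presented tree decompositions of subgraphs of `G` with bags of size at most `k`:
`IsRootedDec G k 𝓑 F S` says that there is one with set of bags `𝓑`, set of edges `F` and root
bag `S`. Two decompositions are joined by an edge between their roots. -/
inductive IsRootedDec (G : UGraph.{u}) (k : ℕ) : Set (Set G.V) → Set G.E → Set G.V → Prop
  | leaf (S : Set G.V) (F : Set G.E) (hF : ∀ e ∈ F, ∀ v ∈ G.ends e, v ∈ S) (hS : S.ncard ≤ k) :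
      IsRootedDec G k {S} F S
  | join {𝓑 𝓑' : Set (Set G.V)} {F F' : Set G.E} {S S' : Set G.V} :
      IsRootedDec G k 𝓑 F S → IsRootedDec G k 𝓑' F' S' → ⋃₀ 𝓑 ∩ ⋃₀ 𝓑' ⊆ S ∩ S' →
      Disjoint F F' → IsRootedDec G k (𝓑 ∪ 𝓑') (F ∪ F') S

namespace IsRootedDec

variable {G : UGraph.{u}} {k : ℕ} {𝓑 : Set (Set G.V)} {F : Set G.E} {S : Set G.V}

theorem root_mem (d : IsRootedDec G k 𝓑 F S) : S ∈ 𝓑 := by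
  induction d with
  | leaf => rfl
  | join _ _ _ _ ih _ => exact Or.inl ih

theorem root_subset (d : IsRootedDec G k 𝓑 F S) : S ⊆ ⋃₀ 𝓑 :=
  Set.subset_sUnion_of_mem d.root_mem

theorem ncard_root_le (d : IsRootedDec G k 𝓑 F S) : S.ncard ≤ k := by
  induction d with
  | leaf _ _ _ hS => exact hS
  | join _ _ _ _ ih _ => exact ih

theorem ends_mem (d : IsRootedDec G k 𝓑 F S) : ∀ e ∈ F, ∀ v ∈ G.ends e, v ∈ ⋃₀ 𝓑 := by
  induction d with
  | leaf S F hF _ => simpa using hF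
  | join _ _ _ _ ih ih' =>
    rw [Set.sUnion_union]
    rintro e (he | he) v hv
    exacts [Or.inl (ih e he v hv), Or.inr (ih' e he v hv)]

/-- A further bag can be attached to any bag of a decomposition. -/
theorem attach (d : IsRootedDec G k 𝓑 F S) {B S' : Set G.V} {F' : Set G.E} (hB : B ∈ 𝓑)
    (hSB : S' ∩ ⋃₀ 𝓑 ⊆ B) (hF' : ∀ e ∈ F', ∀ v ∈ G.ends e, v ∈ S') (hS' : S'.ncard ≤ k)
    (hFF' : Disjoint F F') : IsRootedDec G k (insert S' 𝓑) (F ∪ F') S := by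
  induction d with
  | leaf S F hF hS =>
    have := (leaf S F hF hS).join (leaf S' F' hF' hS') (by simp) hFF'
    rwa [Set.union_comm {S}] at this
  | @join 𝓑₁ 𝓑₂ F₁ F₂ S₁ S₂ d₁ d₂ hS hF ih₁ ih₂ =>
    rw [Set.disjoint_union_left] at hFF'
    rw [Set.sUnion_union] at hSB
    rcases hB with hB | hB
    -- The bag is attached in the part that contains `B`. What it shares with the other part lies in
    -- `B`, hence was already in the old overlap.
    · have hS₂ : ⋃₀ insert S' 𝓑₁ ∩ ⋃₀ 𝓑₂ ⊆ S₁ ∩ S₂ := by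
        rw [Set.sUnion_insert]
        rintro v ⟨h | h, hv⟩
        · exact hS ⟨⟨B, hB, hSB ⟨h, Or.inr hv⟩⟩, hv⟩
        · exact hS ⟨h, hv⟩
      have := (ih₁ hB (fun v hv => hSB ⟨hv.1, Or.inl hv.2⟩) hFF'.1).join d₂ hS₂
        (Set.disjoint_union_left.2 ⟨hF, hFF'.2.symm⟩)
      rwa [Set.insert_union, Set.union_right_comm] at this
    · have hS₂ : ⋃₀ 𝓑₁ ∩ ⋃₀ insert S' 𝓑₂ ⊆ S₁ ∩ S₂ := by
        rw [Set.sUnion_insert]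
        rintro v ⟨hv, h | h⟩
        · exact hS ⟨hv, ⟨B, hB, hSB ⟨h, Or.inl hv⟩⟩⟩
        · exact hS ⟨hv, h⟩
      have := d₁.join (ih₂ hB (fun v hv => hSB ⟨hv.1, Or.inr hv.2⟩) hFF'.2) hS₂
        (Set.disjoint_union_right.2 ⟨hF, hFF'.1⟩)
      rwa [Set.union_insert, ← Set.union_assoc] at this

/-- A recursively presented decomposition yields a tree with bags, where the nodes whose bag
contains a given vertex are connected by walks among themselves. -/
theorem exists_tree (d : IsRootedDec G k 𝓑 F S) :
    ∃ (N : Type) (_ : Fintype N) (T : SimpleGraph N) (bag : N → Set G.V) (r : N),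
      T.IsTree ∧ bag r = S ∧ Set.range bag = 𝓑 ∧ (∀ e ∈ F, ∃ i, ∀ v ∈ G.ends e, v ∈ bag i) ∧
      (∀ i, (bag i).ncard ≤ k) ∧
      ∀ v i j, v ∈ bag i → v ∈ bag j → ∃ p : T.Walk i j, ∀ l ∈ p.support, v ∈ bag l := by
  induction d with
  | leaf S F hF hS =>
    refine ⟨Unit, inferInstance, ⊥, fun _ => S, (), .of_subsingleton, rfl, by simp,
      fun e he => ⟨(), hF e he⟩, fun _ => hS, fun v _ _ hv _ => ⟨.nil, fun _ _ => hv⟩⟩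
  | @join 𝓑 𝓑' F F' S S' d d' hS _ ih ih' =>
    obtain ⟨N, _, T, bag, r, hT, hr, hbag, hF, hk, hw⟩ := ih
    obtain ⟨N', _, T', bag', r', hT', hr', hbag', hF', hk', hw'⟩ := ih'
    have hadj : ((T ⊕g T') ⊔ SimpleGraph.edge (Sum.inl r) (Sum.inr r')).Adj
        (Sum.inl r) (Sum.inr r') := Or.inr (by simp [SimpleGraph.edge_adj])
    let ι : T →g (T ⊕g T') ⊔ SimpleGraph.edge (Sum.inl r) (Sum.inr r') :=
      (SimpleGraph.Hom.ofLE le_sup_left).comp SimpleGraph.Embedding.sumInl.toHom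
    let ι' : T' →g (T ⊕g T') ⊔ SimpleGraph.edge (Sum.inl r) (Sum.inr r') :=
      (SimpleGraph.Hom.ofLE le_sup_left).comp SimpleGraph.Embedding.sumInr.toHom
    -- A vertex with bags on both sides lies in both root bags, so its walk can cross the joining
    -- edge.
    have key : ∀ v i j, v ∈ bag i → v ∈ bag' j →
        ∃ p : ((T ⊕g T') ⊔ SimpleGraph.edge (Sum.inl r) (Sum.inr r')).Walk
          (Sum.inl i) (Sum.inr j), ∀ l ∈ p.support, v ∈ Sum.elim bag bag' l := by
      intro v i j hi hj
      have hv : v ∈ S ∩ S' := hS ⟨⟨_, hbag ▸ ⟨i, rfl⟩, hi⟩, ⟨_, hbag' ▸ ⟨j, rfl⟩, hj⟩⟩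
      obtain ⟨p, hp⟩ := hw v i r hi (hr ▸ hv.1)
      obtain ⟨p', hp'⟩ := hw' v r' j (hr' ▸ hv.2) hj
      obtain ⟨q, hq⟩ := p.exists_map_support ι (P := fun l => v ∈ Sum.elim bag bag' l) hp
      obtain ⟨q', hq'⟩ := p'.exists_map_support ι' (P := fun l => v ∈ Sum.elim bag bag' l) hp'
      refine ⟨q.append (.cons hadj q'), fun l hl => ?_⟩
      rcases (SimpleGraph.Walk.mem_support_append_iff _ _).1 hl with hl | hl
      · exact hq l hl
      · rcases List.mem_cons.1 hl with rfl | hl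
        · exact (hr.ge hv.1 : v ∈ bag r)
        · exact hq' l hl
    refine ⟨N ⊕ N', inferInstance, (T ⊕g T') ⊔ SimpleGraph.edge (Sum.inl r) (Sum.inr r'),
      Sum.elim bag bag', Sum.inl r, hT.sum_sup_edge hT' r r', hr,
      by rw [Set.Sum.elim_range, hbag, hbag'], ?_, ?_, ?_⟩
    · rintro e (he | he)
      · obtain ⟨i, hi⟩ := hF e he
        exact ⟨Sum.inl i, hi⟩
      · obtain ⟨i, hi⟩ := hF' e he
        exact ⟨Sum.inr i, hi⟩
    · rintro (i | i)
      exacts [hk i, hk' i]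
    · rintro v (i | i) (j | j) hi hj
      · obtain ⟨p, hp⟩ := hw v i j hi hj
        exact p.exists_map_support ι (P := fun l => v ∈ Sum.elim bag bag' l) hp
      · exact key v i j hi hj
      · obtain ⟨p, hp⟩ := key v j i hj hi
        exact ⟨p.reverse, fun l hl => hp l (by simpa using hl)⟩
      · obtain ⟨p, hp⟩ := hw' v i j hi hj
        exact p.exists_map_support ι' (P := fun l => v ∈ Sum.elim bag bag' l) hp

/-- Connectivity of the nodes whose bags contain `v` implies the path condition, because in a tree
the path between two nodes is contained in every walk between them. -/
theorem treeWidth_le (d : IsRootedDec G k 𝓑 F S) (hU : ⋃₀ 𝓑 = Set.univ) (hF : F = Set.univ) :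
    G.treeWidth ≤ k := by
  obtain ⟨N, _, T, bag, r, hT, -, hbag, hE, hk, hw⟩ := d.exists_tree
  let D : G.TreeDecomposition :=
    { node := N
      tree := T
      isTree := hT
      bag := bag
      vertex_mem := by rw [← Set.sUnion_range, hbag, hU]
      edge_subset := fun e => hE e (hF ▸ Set.mem_univ e)
      inter_subset := by
        rintro i k p hp j hj v ⟨hi, hk⟩
        obtain ⟨q, hq⟩ := hw v i k hi hk
        exact hq j (hT.isAcyclic.support_subset hp q hj) }
  exact (Nat.sInf_le (Set.mem_range_self D)).trans (Finset.sup_le fun i _ => hk i)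

end IsRootedDec

/-- The edges that lie in one of the given bags. -/
def coveredEdges (G : UGraph.{u}) {N : Type*} (bag : N → Set G.V) (M : Set N) : Set G.E :=
  {e | ∃ i ∈ M, ∀ v ∈ G.ends e, v ∈ bag i}

/-- The bags of a tree decomposition can be collected one at a time. -/
theorem TreeDecomposition.exists_isRootedDec {G : UGraph.{u}} (D : G.TreeDecomposition) :
    ∃ (𝓑 : Set (Set G.V)) (S : Set G.V), ⋃₀ 𝓑 = Set.univ ∧ IsRootedDec G D.width 𝓑 Set.univ S := by
  have hw (i : D.node) : (D.bag i).ncard ≤ D.width :=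
    Finset.le_sup (f := fun i => (D.bag i).ncard) (Finset.mem_univ i)
  -- The node sets of nonempty subtrees whose bags are already collected. A maximal one is shown to
  -- contain every node.
  let P : Set (Set D.node) := {M | M.Nonempty ∧
    (∀ i ∈ M, ∀ j ∈ M, ∃ p : D.tree.Walk i j, p.IsPath ∧ ∀ l ∈ p.support, l ∈ M) ∧
    ∃ S, IsRootedDec G D.width (D.bag '' M) (G.coveredEdges D.bag M) S}
  obtain ⟨r⟩ := D.isTree.connected.nonempty
  have hr : {r} ∈ P := by
    refine ⟨⟨r, rfl⟩, ?_, D.bag r, ?_⟩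
    · rintro _ rfl _ rfl
      exact ⟨.nil, by simp, by simp⟩
    · rw [Set.image_singleton]
      exact .leaf _ _ (by simp [coveredEdges]) (hw r)
  obtain ⟨M, hM⟩ := (Set.toFinite P).exists_maximal ⟨_, hr⟩
  obtain ⟨⟨m, hm⟩, hpath, S, hS⟩ := hM.prop
  have huniv : M = Set.univ := by
    by_contra hne
    obtain ⟨n, hn⟩ := (Set.ne_univ_iff_exists_notMem M).1 hne
    obtain ⟨q⟩ := D.isTree.connected m n
    -- An edge leaving `M`; its outer end `l` can be added, contradicting maximality.
    obtain ⟨⟨⟨i, l⟩, hil⟩, -, hi, hl⟩ := q.exists_boundary_dart M hm hn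
    change i ∈ M at hi
    change l ∉ M at hl
    change D.tree.Adj i l at hil
    -- Every path from `M` to `l` enters through `i`, so the path condition puts the overlap of the
    -- bag of `l` with the collected bags inside the bag of `i`.
    have hto (j) (hj : j ∈ M) : ∃ p : D.tree.Walk j l, p.IsPath ∧
        i ∈ p.support ∧ ∀ x ∈ p.support, x ∈ insert l M := by
      obtain ⟨p, hp, hpM⟩ := hpath j hj i hi
      refine ⟨p.concat hil, hp.concat (fun h => hl (hpM l h)) hil, ?_, ?_⟩
      · simp [SimpleGraph.Walk.support_concat]
      · intro x hx
        rw [SimpleGraph.Walk.support_concat, List.mem_append,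
          List.mem_singleton] at hx
        exact hx.symm.imp id (hpM x)
    refine hl (hM.le_of_ge (y := insert l M) ⟨⟨l, Or.inl rfl⟩, ?_, S, ?_⟩
      (Set.subset_insert l M) (Set.mem_insert l M))
    · rintro x (rfl | hx) y (rfl | hy)
      · exact ⟨.nil, by simp, by simp⟩
      · obtain ⟨p, hp, -, hp'⟩ := hto y hy
        exact ⟨p.reverse, hp.reverse, fun z hz => hp' z (by simpa using hz)⟩
      · obtain ⟨p, hp, -, hp'⟩ := hto x hx
        exact ⟨p, hp, hp'⟩
      · obtain ⟨p, hp, hp'⟩ := hpath x hx y hy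
        exact ⟨p, hp, fun z hz => Or.inr (hp' z hz)⟩
    -- Only edges not yet covered are assigned to the new bag, since the edge sets have to be
    -- disjoint.
    · have := hS.attach (B := D.bag i) (S' := D.bag l)
        (F' := G.coveredEdges D.bag {l} \ G.coveredEdges D.bag M) ⟨i, hi, rfl⟩ ?_ ?_ (hw l)
        Set.disjoint_sdiff_right
      · rw [Set.union_sdiff_self, ← Set.image_insert_eq] at this
        convert this using 1
        ext e
        simp [coveredEdges, or_comm]
      · rintro v ⟨hv, _, ⟨j, hj, rfl⟩, hvj⟩
        obtain ⟨p, hp, hip, -⟩ := hto j hj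
        exact D.inter_subset j l p hp i hip ⟨hvj, hv⟩
      · rintro e ⟨⟨_, rfl, he⟩, -⟩
        exact he
  subst huniv
  refine ⟨D.bag '' Set.univ, S, by rw [Set.image_univ, Set.sUnion_range, D.vertex_mem], ?_⟩
  convert hS
  refine (Set.eq_univ_of_forall fun e => ?_).symm
  obtain ⟨i, hi⟩ := D.edge_subset e
  exact ⟨i, Set.mem_univ i, hi⟩

end UGraph

/-! ### Reversal of cospans -/

namespace GraphCospan

open UGraph

variable {X Y Z X' Y' : Type u}

/-- The reverse of a cospan. -/
abbrev reverse (g : GraphCospan X Y) : GraphCospan Y X := ⟨g.apex, g.right, g.left⟩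

def Iso.reverse {g h : GraphCospan X Y} (i : Iso g h) : Iso g.reverse h.reverse where
  vert := i.vert
  edge := i.edge
  ends_edge := i.ends_edge
  vert_left := i.vert_right
  vert_right := i.vert_left

def reverseComp (g : GraphCospan X Y) (h : GraphCospan Y Z) :
    Iso (g.comp h).reverse (h.reverse.comp g.reverse) where
  vert :=
    { toFun := Glue.desc Glue.inr Glue.inl (fun s => (Glue.condition s).symm)
      invFun := Glue.desc Glue.inr Glue.inl (fun s => (Glue.condition s).symm)
      left_inv := Glue.ind (fun _ => rfl) (fun _ => rfl)
      right_inv := Glue.ind (fun _ => rfl) (fun _ => rfl) }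
  edge := Equiv.sumComm _ _
  ends_edge := by
    rintro (e | e) <;> change _ = Sym2.map _ (Sym2.map _ _) <;> rw [Sym2.map_map] <;> rfl
  vert_left _ := rfl
  vert_right _ := rfl

def reverseOfEquiv [Finite X] [Finite Y] (e : X ≃ Y) :
    Iso (ofFun e).reverse (ofFun e.symm) where
  vert := e.symm
  edge := .refl _
  ends_edge := fun a => a.elim
  vert_left _ := rfl
  vert_right := e.symm_apply_apply

/-- An isomorphism of cospans from bijective maps of vertices and edges. -/
noncomputable def isoOfBijective {g h : GraphCospan X Y} (φ : g.apex.V → h.apex.V)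
    (ψ : g.apex.E → h.apex.E) (hφ : φ.Bijective) (hψ : ψ.Bijective)
    (hends : ∀ e, h.apex.ends (ψ e) = (g.apex.ends e).map φ)
    (hl : ∀ x, φ (g.left x) = h.left x) (hr : ∀ y, φ (g.right y) = h.right y) : Iso g h where
  vert := .ofBijective φ hφ
  edge := .ofBijective ψ hψ
  ends_edge := hends
  vert_left := hl
  vert_right := hr

end GraphCospan

/-! ### Identifications in a pushout -/

namespace UGraph.Glue

variable {S A B : Type u} {f : S → A} {g : S → B}

/-- Tested by a map to `Option B` that collapses `A` and the range of `g` to `none` and is injective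
on the rest of `B`. -/
theorem mem_range_of_inl_eq_inr {a : A} {b : B} (h : (inl a : Glue f g) = inr b) :
    b ∈ Set.range g := by
  classical
  by_contra hb
  have := congrArg (desc (fun _ => none) (fun b => if b ∈ Set.range g then none else some b)
    (fun s => by simp)) h
  simp [-Set.mem_range, hb] at this

/-- The same test map applies. This is why gluing on the left can collapse only the left foot of the
right factor. -/
theorem eq_or_mem_range_of_inr_eq_inr {b b' : B} (h : (inr b : Glue f g) = inr b') :
    b = b' ∨ b ∈ Set.range g ∧ b' ∈ Set.range g := by
  classical
  have := congrArg (desc (fun _ => none) (fun b => if b ∈ Set.range g then none else some b)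
    (fun s => by simp)) h
  rw [desc_inr, desc_inr] at this
  split_ifs at this with hb hb'
  · exact Or.inr ⟨hb, hb'⟩
  · exact Or.inl (Option.some_injective _ this)

end UGraph.Glue

namespace CospanGraph

open MonoidalWidth

/-! ### Reversal exchanges left and right decompositions -/

/-- Reversal of cospans. -/
def dagger {X Y : CospanGraph.{u}} (f : X ⟶ Y) : Y ⟶ X :=
  Quotient.map (sa := GraphCospan.setoid _ _) (sb := GraphCospan.setoid _ _)
    GraphCospan.reverse (fun _ _ ⟨i⟩ => ⟨i.reverse⟩) f

theorem dagger_comp {X Y Z : CospanGraph.{u}} (f : X ⟶ Y) (g : Y ⟶ Z) :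
    dagger (f ≫ g) = dagger g ≫ dagger f := by
  obtain ⟨f⟩ := f
  obtain ⟨g⟩ := g
  exact ofCospan_eq (GraphCospan.reverseComp f g)

theorem dagger_tensor {X Y X' Y' : CospanGraph.{u}} (f : X ⟶ Y) (g : X' ⟶ Y') :
    dagger (f ⊗ₘ g) = dagger f ⊗ₘ dagger g := by
  obtain ⟨f⟩ := f
  obtain ⟨g⟩ := g
  rfl

theorem dagger_ofEquiv_hom {X Y : CospanGraph.{u}} (e : X.carrier ≃ Y.carrier) :
    dagger (ofEquiv e).hom = (ofEquiv e).inv :=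
  ofCospan_eq (GraphCospan.reverseOfEquiv e)

theorem dagger_ofEquiv_inv {X Y : CospanGraph.{u}} (e : X.carrier ≃ Y.carrier) :
    dagger (ofEquiv e).inv = (ofEquiv e).hom :=
  ofCospan_eq (GraphCospan.reverseOfEquiv e.symm)

theorem apexCard_dagger {X Y : CospanGraph.{u}} (f : X ⟶ Y) :
    apexCard (dagger f) = apexCard f := by
  obtain ⟨f⟩ := f
  rfl

/-- Reversal inverts bijections, so it exchanges the associators and unitors with their inverses. -/
theorem isStructural_dagger {X Y : CospanGraph.{u}} {f : X ⟶ Y} (hf : IsStructural f) :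
    IsStructural (dagger f) := by
  induction hf with
  | id A => exact .id A
  | comp _ _ ih ih' => rw [dagger_comp]; exact .comp ih' ih
  | tensor _ _ ih ih' => rw [dagger_tensor]; exact .tensor ih ih'
  | associator_hom A B D =>
    exact (dagger_ofEquiv_hom (X := (A ⊗ B) ⊗ D) (Y := A ⊗ (B ⊗ D)) _).symm ▸
      IsStructural.associator_inv A B D
  | associator_inv A B D =>
    exact (dagger_ofEquiv_inv (X := (A ⊗ B) ⊗ D) (Y := A ⊗ (B ⊗ D)) _).symm ▸
      IsStructural.associator_hom A B D
  | leftUnitor_hom A =>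
    exact (dagger_ofEquiv_hom (X := 𝟙_ _ ⊗ A) _).symm ▸ IsStructural.leftUnitor_inv A
  | leftUnitor_inv A =>
    exact (dagger_ofEquiv_inv (X := 𝟙_ _ ⊗ A) _).symm ▸ IsStructural.leftUnitor_hom A
  | rightUnitor_hom A =>
    exact (dagger_ofEquiv_hom (X := A ⊗ 𝟙_ _) _).symm ▸ IsStructural.rightUnitor_inv A
  | rightUnitor_inv A =>
    exact (dagger_ofEquiv_inv (X := A ⊗ 𝟙_ _) _).symm ▸ IsStructural.rightUnitor_hom A

theorem exists_leftTreeDec_dagger {A B : CospanGraph.{u}} {f : A ⟶ B} (d : RightTreeDec ⊤ f) :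
    ∃ d' : LeftTreeDec ⊤ (dagger f), d'.width weight = d.width weight := by
  induction d with
  | leaf f hf => exact ⟨.leaf _ trivial, apexCard_dagger f⟩
  | tensor d₁ d₂ ih₁ ih₂ =>
    obtain ⟨d₁', h₁⟩ := ih₁
    obtain ⟨d₂', h₂⟩ := ih₂
    rw [dagger_tensor]
    exact ⟨.tensor d₁' d₂', by simp only [LeftTreeDec.width, RightTreeDec.width, h₁, h₂]⟩
  | @comp A X B g hg f d ih =>
    obtain ⟨d', h⟩ := ih
    rw [dagger_comp]
    refine ⟨.comp d' (dagger g) trivial, ?_⟩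
    have hg : weight.hom (dagger g) trivial = weight.hom g hg := apexCard_dagger g
    simp only [LeftTreeDec.width, RightTreeDec.width, h, hg]
    rw [max_comm, max_assoc, max_left_comm]
  | coherence ha d hb ih =>
    obtain ⟨d', h⟩ := ih
    rw [dagger_comp, dagger_comp, Category.assoc]
    exact ⟨.coherence (isStructural_dagger hb) d' (isStructural_dagger ha), h⟩

theorem exists_rightTreeDec_dagger {A B : CospanGraph.{u}} {f : A ⟶ B} (d : LeftTreeDec ⊤ f) :
    ∃ d' : RightTreeDec ⊤ (dagger f), d'.width weight = d.width weight := by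
  induction d with
  | leaf f hf => exact ⟨.leaf _ trivial, apexCard_dagger f⟩
  | tensor d₁ d₂ ih₁ ih₂ =>
    obtain ⟨d₁', h₁⟩ := ih₁
    obtain ⟨d₂', h₂⟩ := ih₂
    rw [dagger_tensor]
    exact ⟨.tensor d₁' d₂', by simp only [LeftTreeDec.width, RightTreeDec.width, h₁, h₂]⟩
  | @comp A X B f d g hg ih =>
    obtain ⟨d', h⟩ := ih
    rw [dagger_comp]
    refine ⟨.comp (dagger g) trivial d', ?_⟩
    have hg : weight.hom (dagger g) trivial = weight.hom g hg := apexCard_dagger g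
    simp only [LeftTreeDec.width, RightTreeDec.width, h, hg]
    rw [max_comm, max_assoc, max_left_comm]
  | coherence ha d hb ih =>
    obtain ⟨d', h⟩ := ih
    rw [dagger_comp, dagger_comp, Category.assoc]
    exact ⟨.coherence (isStructural_dagger hb) d' (isStructural_dagger ha), h⟩

/-- Both legs of `ofGraph G` are the empty function, so it equals its own reverse by definition and
the two sets of widths coincide. -/
theorem leftTreeWidth_ofGraph (G : UGraph.{u}) :
    leftTreeWidth weight (ofGraph G) = rightTreeWidth weight (ofGraph G) := by
  unfold leftTreeWidth rightTreeWidth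
  congr 1
  ext n
  constructor
  · rintro ⟨d, rfl⟩
    exact exists_rightTreeDec_dagger d
  · rintro ⟨d, rfl⟩
    exact exists_leftTreeDec_dagger d

/-! ### From monoidal decompositions to tree decompositions -/

theorem exists_equiv_of_isStructural {X Y : CospanGraph.{u}} {f : X ⟶ Y} (hf : IsStructural f) :
    ∃ e : X.carrier ≃ Y.carrier, f = ofCospan (GraphCospan.ofFun e) := by
  induction hf with
  | id A => exact ⟨.refl _, rfl⟩
  | comp _ _ ih ih' =>
    obtain ⟨e, rfl⟩ := ih
    obtain ⟨e', rfl⟩ := ih'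
    exact ⟨e.trans e', ofFun_comp_ofFun _ _⟩
  | tensor _ _ ih ih' =>
    obtain ⟨e, rfl⟩ := ih
    obtain ⟨e', rfl⟩ := ih'
    exact ⟨Equiv.sumCongr e e', ofFun_tensor _ _⟩
  | associator_hom A B D => exact ⟨_, rfl⟩
  | associator_inv A B D => exact ⟨_, rfl⟩
  | leftUnitor_hom A => exact ⟨_, rfl⟩
  | leftUnitor_inv A => exact ⟨_, rfl⟩
  | rightUnitor_hom A => exact ⟨_, rfl⟩
  | rightUnitor_inv A => exact ⟨_, rfl⟩

end CospanGraph

/-! ### Rooted decompositions with the left foot in the root bag -/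

namespace GraphCospan

open UGraph

variable {X Y Z X' Y' : Type u}

/-- A morphism of graphs from the apex of a cospan that identifies only vertices in the image of
the left foot. -/
structure IsAlmostEmbedding (c : GraphCospan X Y) {G : UGraph.{u}} (φ : c.apex.V → G.V)
    (ψ : c.apex.E → G.E) : Prop where
  ends_eq : ∀ e, G.ends (ψ e) = (c.apex.ends e).map φ
  injective_edge : ψ.Injective
  eq_or : ∀ v w, φ v = φ w → v = w ∨ v ∈ Set.range c.left ∧ w ∈ Set.range c.left

/-- Every almost embedded image of the cospan has a decomposition with bags of size at most `k`
whose root bag contains the image of the left foot. -/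
def HasRootedDec (k : ℕ) (c : GraphCospan X Y) : Prop :=
  ∀ ⦃G : UGraph.{u}⦄ ⦃φ : c.apex.V → G.V⦄ ⦃ψ : c.apex.E → G.E⦄, c.IsAlmostEmbedding φ ψ →
    ∃ (𝓑 : Set (Set G.V)) (S : Set G.V), ⋃₀ 𝓑 = Set.range φ ∧ (∀ x, φ (c.left x) ∈ S) ∧
      IsRootedDec G k 𝓑 (Set.range ψ) S

theorem IsAlmostEmbedding.mem_range {c : GraphCospan X Y} {G : UGraph.{u}} {φ : c.apex.V → G.V}
    {ψ : c.apex.E → G.E} (h : c.IsAlmostEmbedding φ ψ) {v w : c.apex.V} (hvw : φ v = φ w)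
    (hv : v ∈ Set.range c.left) : w ∈ Set.range c.left := by
  rcases h.eq_or v w hvw with rfl | h
  exacts [hv, h.2]

theorem HasRootedDec.of_iso {k : ℕ} {c c' : GraphCospan X Y} (h : c.HasRootedDec k)
    (i : Iso c c') : c'.HasRootedDec k := by
  intro G φ ψ hφ
  obtain ⟨𝓑, S, hU, hS, d⟩ := @h G (φ ∘ i.vert) (ψ ∘ i.edge)
    { ends_eq := fun e => by
        rw [Function.comp_apply, hφ.ends_eq, i.ends_edge, Sym2.map_map]
      injective_edge := hφ.injective_edge.comp i.edge.injective
      eq_or := fun v w hvw => by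
        have hr (v) (hv : i.vert v ∈ Set.range c'.left) : v ∈ Set.range c.left := by
          obtain ⟨x, hx⟩ := hv
          exact ⟨x, i.vert.injective ((i.vert_left x).trans hx)⟩
        exact (hφ.eq_or _ _ hvw).imp (fun h => i.vert.injective h) (And.imp (hr v) (hr w)) }
  rw [EquivLike.range_comp] at hU d
  exact ⟨𝓑, S, hU, fun x => i.vert_left x ▸ hS x, d⟩

theorem hasRootedDec_of_card_le {k : ℕ} (c : GraphCospan X Y) (hk : Nat.card c.apex.V ≤ k) :
    c.HasRootedDec k := by
  intro G φ ψ hφ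
  refine ⟨{Set.range φ}, Set.range φ, by simp, fun x => ⟨_, rfl⟩, .leaf _ _ ?_ ?_⟩
  · rintro _ ⟨e, rfl⟩ v hv
    rw [hφ.ends_eq, Sym2.mem_map] at hv
    obtain ⟨w, -, rfl⟩ := hv
    exact ⟨w, rfl⟩
  · exact (Nat.card_coe_set_eq _).symm.trans_le ((Finite.card_range_le _).trans hk)

/-- The range of the left leg must not change, so `a` is a bijection; the right foot plays no role,
so `b` is arbitrary. -/
theorem HasRootedDec.reindex {k : ℕ} {c : GraphCospan X Y} (h : c.HasRootedDec k) (a : X' ≃ X)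
    (b : Y' → Y) : (c.reindex a b).HasRootedDec k := by
  intro G φ ψ hφ
  have hr : Set.range (c.left ∘ a) = Set.range c.left := EquivLike.range_comp _ _
  obtain ⟨𝓑, S, hU, hS, d⟩ := @h G φ ψ
    { ends_eq := hφ.ends_eq
      injective_edge := hφ.injective_edge
      eq_or := fun v w hvw => by simpa only [GraphCospan.reindex, hr] using hφ.eq_or v w hvw }
  exact ⟨𝓑, S, hU, fun x => hS (a x), d⟩

/-- The image of the apex of `g` becomes the root bag. It contains the left foot of the composite
and meets the bags of `c` only in the image of the foot `Y`, which lies in the root bag of `c`. -/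
theorem HasRootedDec.comp {k : ℕ} (g : GraphCospan X Y) {c : GraphCospan Y Z}
    (hg : Nat.card g.apex.V ≤ k) (hc : c.HasRootedDec k) : (g.comp c).HasRootedDec k := by
  intro G φ ψ hφ
  have hleft {b : c.apex.V} (h : Glue.inr b ∈ Set.range (g.comp c).left) :
      b ∈ Set.range c.left := by
    obtain ⟨x, hx⟩ := h
    exact Glue.mem_range_of_inl_eq_inr hx
  obtain ⟨𝓑, S, hU, hS, d⟩ := @hc G (fun b => φ (Glue.inr b)) (fun e => ψ (Sum.inr e))
    { ends_eq := fun e => by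
        rw [hφ.ends_eq]
        exact Sym2.map_map _
      injective_edge := hφ.injective_edge.comp Sum.inr_injective
      eq_or := fun v w hvw => by
        rcases hφ.eq_or _ _ hvw with h | ⟨hv, hw⟩
        · exact Glue.eq_or_mem_range_of_inr_eq_inr h
        · exact Or.inr ⟨hleft hv, hleft hw⟩ }
  let φ' : g.apex.V → G.V := fun a => φ (Glue.inl a)
  let ψ' : g.apex.E → G.E := fun e => ψ (Sum.inl e)
  have d' : IsRootedDec G k {Set.range φ'} (Set.range ψ') (Set.range φ') := by
    refine .leaf _ _ ?_ ?_
    · rintro _ ⟨e, rfl⟩ v hv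
      rw [hφ.ends_eq, Sym2.mem_map] at hv
      obtain ⟨w, hw, rfl⟩ := hv
      obtain ⟨a, -, rfl⟩ := Sym2.mem_map.1 hw
      exact ⟨a, rfl⟩
    · exact (Nat.card_coe_set_eq _).symm.trans_le ((Finite.card_range_le _).trans hg)
  have key : ⋃₀ {Set.range φ'} ∩ ⋃₀ 𝓑 ⊆ Set.range φ' ∩ S := by
    rw [Set.sUnion_singleton, hU]
    rintro _ ⟨⟨a, rfl⟩, b, hb⟩
    refine ⟨⟨a, rfl⟩, ?_⟩
    -- Either `a` and `b` are already equal in the pushout, or `φ` identifies them and `b` lies in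
    -- the left foot of the composite, which comes from `g`; both force `b` into the foot `Y`.
    obtain ⟨y, rfl⟩ : b ∈ Set.range c.left := by
      rcases hφ.eq_or _ _ hb with h | ⟨h, -⟩
      · exact Glue.mem_range_of_inl_eq_inr h.symm
      · exact hleft h
    exact hb ▸ hS y
  have hdisj : Disjoint (Set.range ψ') (Set.range fun e => ψ (Sum.inr e)) := by
    rw [Set.disjoint_left]
    rintro _ ⟨e, rfl⟩ ⟨e', he⟩
    exact Sum.inr_ne_inl (hφ.injective_edge he)
  refine ⟨{Set.range φ'} ∪ 𝓑, Set.range φ', ?_, fun x => ⟨g.left x, rfl⟩, ?_⟩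
  rotate_left
  · convert d'.join d key hdisj
    exact (Set.range_eq_iff _ _).2 ⟨by rintro (e | e) <;> simp [ψ'], by
      rintro _ (⟨e, rfl⟩ | ⟨e, rfl⟩) <;> exact ⟨_, rfl⟩⟩
  · rw [Set.sUnion_union, Set.sUnion_singleton, hU]
    refine Set.Subset.antisymm ?_ ?_
    · rintro _ (⟨e, rfl⟩ | ⟨e, rfl⟩) <;> exact ⟨_, rfl⟩
    · rintro _ ⟨v, rfl⟩
      induction v using Glue.ind with
      | hl a => exact Or.inl ⟨a, rfl⟩
      | hr a => exact Or.inr ⟨a, rfl⟩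

theorem HasRootedDec.tensor {k : ℕ} {c : GraphCospan X Y} {c' : GraphCospan X' Y'}
    [Finite X] [Finite X'] (hk : Nat.card (X ⊕ X') ≤ k)
    (hc : c.HasRootedDec k) (hc' : c'.HasRootedDec k) : (c.tensor c').HasRootedDec k := by
  intro G φ ψ hφ
  have hl {v : c.apex.V} : Sum.inl v ∈ Set.range (c.tensor c').left ↔ v ∈ Set.range c.left := by
    simp [GraphCospan.tensor]
  have hr {v : c'.apex.V} : Sum.inr v ∈ Set.range (c.tensor c').left ↔ v ∈ Set.range c'.left := by
    simp [GraphCospan.tensor]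
  obtain ⟨𝓑, S, hU, hS, d⟩ := @hc G (fun b => φ (Sum.inl b)) (fun e => ψ (Sum.inl e))
    { ends_eq := fun e => by
        rw [hφ.ends_eq]
        exact Sym2.map_map _
      injective_edge := hφ.injective_edge.comp Sum.inl_injective
      eq_or := fun v w hvw => (hφ.eq_or _ _ hvw).imp (fun h => Sum.inl_injective h)
        (And.imp hl.1 hl.1) }
  obtain ⟨𝓑', S', hU', hS', d'⟩ := @hc' G (fun b => φ (Sum.inr b)) (fun e => ψ (Sum.inr e))
    { ends_eq := fun e => by
        rw [hφ.ends_eq]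
        exact Sym2.map_map _
      injective_edge := hφ.injective_edge.comp Sum.inr_injective
      eq_or := fun v w hvw => (hφ.eq_or _ _ hvw).imp (fun h => Sum.inr_injective h)
        (And.imp hr.1 hr.1) }
  -- The extra root bag carries no edges. It separates the factors, whose images can meet only in
  -- the left foot.
  let R : Set G.V := Set.range fun x => φ ((c.tensor c').left x)
  have dR : IsRootedDec G k {R} ∅ R := by
    exact .leaf _ _ (by simp)
      ((Nat.card_coe_set_eq _).symm.trans_le ((Finite.card_range_le _).trans hk))
  have h₁ : ⋃₀ {R} ∩ ⋃₀ 𝓑 ⊆ R ∩ S := by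
    rw [Set.sUnion_singleton, hU]
    rintro _ ⟨⟨x, rfl⟩, b, hb⟩
    obtain ⟨y, rfl⟩ := hl.1 (hφ.mem_range hb.symm ⟨x, rfl⟩)
    exact ⟨⟨x, rfl⟩, hb ▸ hS y⟩
  have h₂ : ⋃₀ ({R} ∪ 𝓑) ∩ ⋃₀ 𝓑' ⊆ R ∩ S' := by
    rw [Set.sUnion_union, Set.sUnion_singleton, hU, hU']
    rintro _ ⟨⟨x, rfl⟩ | ⟨a, rfl⟩, b, hb⟩
    · obtain ⟨y, rfl⟩ := hr.1 (hφ.mem_range hb.symm ⟨x, rfl⟩)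
      exact ⟨⟨x, rfl⟩, hb ▸ hS' y⟩
    -- Vertices of different factors are distinct in the disjoint union, so identifying them forces
    -- both into the left foot.
    · rcases hφ.eq_or _ _ hb with h | ⟨h, h'⟩
      · exact (Sum.inr_ne_inl h).elim
      · obtain ⟨x, hx⟩ := h'
        obtain ⟨y, rfl⟩ := hr.1 h
        exact ⟨⟨x, congrArg φ hx⟩, hb ▸ hS' y⟩
  have hdisj : Disjoint (∅ ∪ Set.range fun e => ψ (Sum.inl e))
      (Set.range fun e => ψ (Sum.inr e)) := by
    rw [Set.empty_union, Set.disjoint_left]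
    rintro _ ⟨e, rfl⟩ ⟨e', he⟩
    exact Sum.inr_ne_inl (hφ.injective_edge he)
  refine ⟨{R} ∪ 𝓑 ∪ 𝓑', R, ?_, fun x => ⟨x, rfl⟩, ?_⟩
  rotate_left
  · convert (dR.join d h₁ (Set.empty_disjoint _)).join d' h₂ hdisj
    rw [Set.empty_union]
    exact (Set.range_eq_iff _ _).2 ⟨by rintro (e | e) <;> simp, by
      rintro _ (⟨e, rfl⟩ | ⟨e, rfl⟩) <;> exact ⟨_, rfl⟩⟩
  · rw [Set.sUnion_union, Set.sUnion_union, Set.sUnion_singleton, hU, hU']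
    refine Set.Subset.antisymm ?_ ?_
    · rintro _ ((⟨e, rfl⟩ | ⟨e, rfl⟩) | ⟨e, rfl⟩) <;> exact ⟨_, rfl⟩
    · rintro _ ⟨v | v, rfl⟩
      exacts [Or.inl (Or.inr ⟨v, rfl⟩), Or.inr ⟨v, rfl⟩]

end GraphCospan

namespace CospanGraph

open MonoidalWidth

/-- The bound on `A` is what makes the root bag of a product fit. It passes to the factors because
sizes add, and it holds after a composition because the width counts the middle object. -/
theorem exists_hasRootedDec {A B : CospanGraph.{u}} {f : A ⟶ B} (d : RightTreeDec ⊤ f) {k : ℕ}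
    (hk : d.width weight ≤ k) (hA : Nat.card A.carrier ≤ k) :
    ∃ c : GraphCospan A.carrier B.carrier, f = ofCospan c ∧ c.HasRootedDec k := by
  induction d with
  | leaf f hf =>
    obtain ⟨c, rfl⟩ := ofCospan_surjective f
    exact ⟨c, rfl, c.hasRootedDec_of_card_le hk⟩
  | @tensor A₁ B₁ A₂ B₂ f₁ f₂ d₁ d₂ ih₁ ih₂ =>
    obtain ⟨hk₁, hk₂⟩ := max_le_iff.1 hk
    have hA' : Nat.card (A₁.carrier ⊕ A₂.carrier) ≤ k := hA
    have hsum := Nat.card_sum (α := A₁.carrier) (β := A₂.carrier)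
    obtain ⟨c₁, rfl, h₁⟩ := ih₁ hk₁ (by omega)
    obtain ⟨c₂, rfl, h₂⟩ := ih₂ hk₂ (by omega)
    exact ⟨c₁.tensor c₂, rfl, h₁.tensor hA' h₂⟩
  | comp g hg d ih =>
    simp only [RightTreeDec.width, max_le_iff] at hk
    obtain ⟨c, rfl, hc⟩ := ih hk.2.2 hk.2.1
    obtain ⟨g, rfl⟩ := ofCospan_surjective g
    exact ⟨g.comp c, rfl, .comp g hk.1 hc⟩
  | @coherence A' A B B' a ha f d b hb ih =>
    obtain ⟨e, rfl⟩ := exists_equiv_of_isStructural ha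
    obtain ⟨e', rfl⟩ := exists_equiv_of_isStructural hb
    obtain ⟨c, rfl, hc⟩ := ih hk (Nat.card_congr e ▸ hA)
    exact ⟨(c.reindex id e'.symm).reindex e id, by rw [comp_ofEquiv, ofFun_comp],
      (hc.reindex (.refl _) e'.symm).reindex e id⟩

theorem exists_width_eq_rightTreeWidth {A B : CospanGraph.{u}} (f : A ⟶ B) :
    ∃ d : RightTreeDec ⊤ f, d.width weight = rightTreeWidth weight f :=
  Nat.sInf_mem (Set.range_nonempty_iff_nonempty.2 ⟨RightTreeDec.leaf f trivial⟩)

theorem treeWidth_le_rightTreeWidth (G : UGraph.{u}) :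
    G.treeWidth ≤ rightTreeWidth weight (ofGraph G) := by
  obtain ⟨d, hd⟩ := exists_width_eq_rightTreeWidth (ofGraph G)
  obtain ⟨c, hc, h⟩ := exists_hasRootedDec d hd.le 
    ((Nat.card_of_isEmpty (α := PEmpty.{u + 1})).trans_le (Nat.zero_le _))
  obtain ⟨i⟩ := Quotient.exact hc
  have h := h.of_iso i.symm
  -- The identity of `G` is an almost embedding, so the decomposition obtained covers all of `G`.
  obtain ⟨𝓑, S, hU, -, h⟩ := @h G id id
    { ends_eq := fun e => by simp
      injective_edge := Function.injective_id
      eq_or := fun v w h => Or.inl h }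
  exact h.treeWidth_le (hU.trans Set.range_id) Set.range_id

end CospanGraph

/-! ### From tree decompositions to monoidal decompositions -/

namespace UGraph

/-- The subgraph on a set `U` of vertices and a set `F` of edges with ends in `U`. -/
def subgraph (G : UGraph.{u}) (U : Set G.V) (F : Set G.E)
    (h : ∀ e ∈ F, ∀ v ∈ G.ends e, v ∈ U) : UGraph.{u} where
  V := U
  E := F
  ends e := (G.ends e).attachWith (h e e.2)

theorem map_val_ends_subgraph {G : UGraph.{u}} {U : Set G.V} {F : Set G.E}
    (h : ∀ e ∈ F, ∀ v ∈ G.ends e, v ∈ U) (e : F) :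
    ((G.subgraph U F h).ends e).map (Subtype.val : U → G.V) = G.ends e :=
  Sym2.attachWith_map_subtypeVal _

end UGraph

namespace CospanGraph

open UGraph MonoidalWidth

/-- The subgraph of `G` on `U` and `F` with a family of vertices as left foot. -/
def subgraphCospan (G : UGraph.{u}) (U : Set G.V) (F : Set G.E)
    (h : ∀ e ∈ F, ∀ v ∈ G.ends e, v ∈ U) {A : Type u} (ι : A → U) : GraphCospan A PEmpty.{u + 1} :=
  ⟨G.subgraph U F h, ι, PEmpty.elim⟩

variable {G : UGraph.{u}}

/-- The union of two subgraphs that meet in `S ∩ S'` is obtained by gluing them along the discrete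
graph `S`, which is copied for the first and restricted to `S ∩ S'` for the second. -/
theorem subgraphCospan_union {U U' S S' : Set G.V} {F F' : Set G.E}
    (h : ∀ e ∈ F, ∀ v ∈ G.ends e, v ∈ U) (h' : ∀ e ∈ F', ∀ v ∈ G.ends e, v ∈ U')
    (hu : ∀ e ∈ F ∪ F', ∀ v ∈ G.ends e, v ∈ U ∪ U')
    (hS : S ⊆ U) (hS' : S' ⊆ U') (hU : U ∩ U' ⊆ S ∩ S') (hF : Disjoint F F')
    {A : CospanGraph.{u}} (ι : A.carrier → ↥(U ∪ U')) (κ : A.carrier → S)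
    (hκ : ∀ a, (ι a : G.V) = κ a) :
    (ofCospan (subgraphCospan G (U ∪ U') (F ∪ F') hu ι) : A ⟶ 𝟙_ CospanGraph.{u}) =
      (ofCospan ⟨discrete S, κ, Sum.elim id (Set.inclusion Set.inter_subset_left)⟩ :
        A ⟶ (⟨S⟩ ⊗ ⟨↥(S ∩ S')⟩ : CospanGraph.{u})) ≫
      𝟙 _ ≫ ((ofCospan (subgraphCospan G U F h (Set.inclusion hS)) : ⟨S⟩ ⟶ 𝟙_ CospanGraph.{u}) ⊗ₘ
        (ofCospan (subgraphCospan G U' F' h'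
          (Set.inclusion (Set.inter_subset_right.trans hS'))) :
            ⟨↥(S ∩ S')⟩ ⟶ 𝟙_ CospanGraph.{u})) ≫ (λ_ (𝟙_ CospanGraph.{u})).hom := by
  rw [Category.id_comp]
  let c : GraphCospan (S ⊕ ↥(S ∩ S')) (PEmpty.{u + 1} ⊕ PEmpty.{u + 1}) :=
    (subgraphCospan G U F h (Set.inclusion hS)).tensor
      (subgraphCospan G U' F' h' (Set.inclusion (Set.inter_subset_right.trans hS')))
  let g : GraphCospan A.carrier (S ⊕ ↥(S ∩ S')) :=
    ⟨discrete S, κ, Sum.elim id (Set.inclusion Set.inter_subset_left)⟩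
  have hc := comp_ofEquiv (X := (⟨S⟩ ⊗ ⟨↥(S ∩ S')⟩ : CospanGraph.{u}))
    (Y := (𝟙_ CospanGraph.{u} ⊗ 𝟙_ CospanGraph.{u})) (Z := 𝟙_ CospanGraph.{u}) c
    (Equiv.emptySum PEmpty PEmpty)
  refine Eq.trans ?_ (congrArg (fun z => ofCospan g ≫ z) hc.symm)
  let q := c.reindex id (Equiv.emptySum PEmpty.{u + 1} PEmpty.{u + 1}).symm
  let φ : (g.comp q).apex.V → ↥(U ∪ U') := Glue.desc (Set.inclusion (hS.trans Set.subset_union_left))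
    (Sum.elim (Set.inclusion Set.subset_union_left) (Set.inclusion Set.subset_union_right))
    (by rintro (s | s) <;> rfl)
  let ψ : (g.comp q).apex.E → ↥(F ∪ F') := Sum.elim PEmpty.elim
    (Sum.elim (Set.inclusion Set.subset_union_left) (Set.inclusion Set.subset_union_right))
  have hg (s : S) : (Glue.inl s : (g.comp q).apex.V) = Glue.inr (Sum.inl (Set.inclusion hS s)) :=
    Glue.condition (f := g.right) (g := q.left) (Sum.inl s)
  have hg' (s : ↥(S ∩ S')) : (Glue.inl (Set.inclusion Set.inter_subset_left s) :
      (g.comp q).apex.V) =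
      Glue.inr (Sum.inr (Set.inclusion (Set.inter_subset_right.trans hS') s)) :=
    Glue.condition (f := g.right) (g := q.left) (Sum.inr s)
  -- A vertex common to `U` and `U'` lies in `S ∩ S'`, so its two copies are glued through the
  -- discrete graph. This is the injectivity of `φ` across the two parts.
  have hcross (x : U) (y : U') (hxy : (x : G.V) = y) :
      (Glue.inr (Sum.inl x) : (g.comp q).apex.V) = Glue.inr (Sum.inr y) := by
    have hx : (x : G.V) ∈ S ∩ S' := hU ⟨x.2, hxy ▸ y.2⟩
    refine ((hg ⟨x, hx.1⟩).symm.trans (hg' ⟨x, hx⟩)).trans ?_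
    exact congrArg (fun y => Glue.inr (Sum.inr y)) (Subtype.ext hxy)
  -- The discrete graph adds no vertices: each of its vertices is glued to one of `U`.
  have hinr (v : (g.comp q).apex.V) : ∃ w : U ⊕ U', v = Glue.inr w := by
    induction v using Glue.ind with
    | hl s => exact ⟨_, hg s⟩
    | hr w => exact ⟨w, rfl⟩
  refine (ofCospan_eq (GraphCospan.isoOfBijective (g := g.comp q)
    (h := subgraphCospan G (U ∪ U') (F ∪ F') hu ι) φ ψ ⟨?_, ?_⟩ ⟨?_, ?_⟩ ?_ ?_ ?_)).symm
  · intro v w hvw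
    obtain ⟨v, rfl⟩ := hinr v
    obtain ⟨w, rfl⟩ := hinr w
    have hvw := congrArg Subtype.val hvw
    rcases v with v | v <;> rcases w with w | w
    · exact congrArg (fun y => Glue.inr (Sum.inl y)) (Subtype.ext hvw)
    · exact hcross v w hvw
    · exact (hcross w v hvw.symm).symm
    · exact congrArg (fun y => Glue.inr (Sum.inr y)) (Subtype.ext hvw)
  · rintro ⟨v, hv | hv⟩
    · exact ⟨Glue.inr (Sum.inl ⟨v, hv⟩), rfl⟩
    · exact ⟨Glue.inr (Sum.inr ⟨v, hv⟩), rfl⟩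
  · rintro (e | e | e) (e' | e' | e') he
    all_goals first | exact e.elim | exact e'.elim | replace he := congrArg Subtype.val he
    · exact congrArg (fun y => Sum.inr (Sum.inl y)) (Subtype.ext he)
    · exact (Set.disjoint_left.1 hF e.2 (he ▸ e'.2)).elim
    · exact (Set.disjoint_left.1 hF e'.2 (he ▸ e.2)).elim
    · exact congrArg (fun y => Sum.inr (Sum.inr y)) (Subtype.ext he)
  · rintro ⟨e, he | he⟩
    · exact ⟨Sum.inr (Sum.inl ⟨e, he⟩), rfl⟩
    · exact ⟨Sum.inr (Sum.inr ⟨e, he⟩), rfl⟩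
  · rintro (e | e | e)
    · exact e.elim
    all_goals
      -- Endpoints are compared inside `G.V`, where all the inclusions become invisible.
      refine Sym2.map.injective Subtype.val_injective ((map_val_ends_subgraph hu _).trans ?_)
      change _ = Sym2.map _ (Sym2.map _ (Sym2.map _ (Sym2.map _ _)))
      rw [Sym2.map_map, Sym2.map_map, Sym2.map_map]
      exact (map_val_ends_subgraph (by assumption) e).symm
  · exact fun a => Subtype.ext (hκ a).symm
  · exact fun y => y.elim

/-- The left foot is an arbitrary family in the root bag, so that the induction hypotheses apply to
the feet `S` and `S ∩ S'` produced by a join, and finally to the empty foot. -/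
theorem exists_rightTreeDec_of_isRootedDec {k : ℕ} {𝓑 : Set (Set G.V)} {F : Set G.E}
    {S : Set G.V} (d : IsRootedDec G k 𝓑 F S) {U : Set G.V} (hU : U = ⋃₀ 𝓑)
    (h : ∀ e ∈ F, ∀ v ∈ G.ends e, v ∈ U) {A : CospanGraph.{u}} (ι : A.carrier → U)
    (hι : ∀ a, (ι a : G.V) ∈ S) :
    ∃ d : RightTreeDec ⊤ (ofCospan (subgraphCospan G U F h ι) : A ⟶ 𝟙_ CospanGraph.{u}),
      d.width weight ≤ 2 * k := by
  induction d generalizing U A with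
  | leaf S F hF hS =>
    rw [Set.sUnion_singleton] at hU
    subst hU
    refine ⟨.leaf _ trivial, ?_⟩
    change Nat.card U ≤ 2 * k
    rw [Nat.card_coe_set_eq]
    omega
  | @join 𝓑 𝓑' F F' S S' d d' hS hF ih ih' =>
    rw [Set.sUnion_union] at hU
    subst hU
    rw [subgraphCospan_union d.ends_mem d'.ends_mem h d.root_subset d'.root_subset hS hF ι
      (fun a => ⟨ι a, hι a⟩) (fun _ => rfl)]
    obtain ⟨e, he⟩ := ih rfl d.ends_mem (A := ⟨S⟩) (Set.inclusion d.root_subset) (fun a => a.2)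
    obtain ⟨e', he'⟩ := ih' rfl d'.ends_mem (A := ⟨↥(S ∩ S')⟩)
      (Set.inclusion (Set.inter_subset_right.trans d'.root_subset)) (fun a => a.2.2)
    refine ⟨.comp _ trivial (.coherence (.id _) (.tensor e e') (.leftUnitor_hom _)), ?_⟩
    have hk := d.ncard_root_le
    have hk' : (S ∩ S').ncard ≤ S.ncard := Set.ncard_le_ncard Set.inter_subset_left
    refine max_le ?_ (max_le ?_ (max_le he he'))
    · change Nat.card S ≤ 2 * k
      rw [Nat.card_coe_set_eq]
      omega
    -- The only place where `2 * k` rather than `k` is needed: the cut contains `S ∩ S'` a second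
    -- time.
    · change Nat.card (S ⊕ ↥(S ∩ S')) ≤ 2 * k
      rw [Nat.card_sum, Nat.card_coe_set_eq, Nat.card_coe_set_eq]
      omega

/-- The decomposition of a graph with a single bag. -/
def _root_.UGraph.trivialTreeDecomposition (G : UGraph.{u}) : G.TreeDecomposition where
  node := Unit
  tree := ⊥
  isTree := .of_subsingleton
  bag _ := Set.univ
  vertex_mem := Set.iUnion_const _
  edge_subset _ := ⟨(), fun _ _ => Set.mem_univ _⟩
  inter_subset _ _ _ _ _ _ := Set.subset_univ _

theorem rightTreeWidth_le_two_mul_treeWidth (G : UGraph.{u}) :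
    rightTreeWidth weight (ofGraph G) ≤ 2 * G.treeWidth := by
  obtain ⟨D, hD⟩ : ∃ D : G.TreeDecomposition, D.width = G.treeWidth :=
    Nat.sInf_mem (Set.range_nonempty_iff_nonempty.2 ⟨G.trivialTreeDecomposition⟩)
  obtain ⟨𝓑, S, hU, d⟩ := D.exists_isRootedDec
  obtain ⟨e, he⟩ := exists_rightTreeDec_of_isRootedDec d hU.symm (fun _ _ _ _ => Set.mem_univ _)
    (A := 𝟙_ CospanGraph.{u}) PEmpty.elim (fun a => a.elim)
  let i : GraphCospan.Iso (subgraphCospan G Set.univ Set.univ (fun _ _ _ _ => Set.mem_univ _)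
      (PEmpty.elim : PEmpty.{u + 1} → _)) ⟨G, PEmpty.elim, PEmpty.elim⟩ :=
    { vert := Equiv.Set.univ G.V
      edge := Equiv.Set.univ G.E
      ends_edge := fun e => (map_val_ends_subgraph (fun _ _ _ _ => Set.mem_univ _) e).symm
      vert_left := fun x => x.elim
      vert_right := fun x => x.elim }
  have h : ofGraph G = _ := (ofCospan_eq (X := 𝟙_ _) (Y := 𝟙_ _) i).symm
  rw [h, ← hD]
  exact (Nat.sInf_le (Set.mem_range_self e)).trans he

end CospanGraph

theorem mainTheorem1 (G : UGraph.{u}) :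
    MonoidalWidth.leftTreeWidth CospanGraph.weight (CospanGraph.ofGraph G) =
        MonoidalWidth.rightTreeWidth CospanGraph.weight (CospanGraph.ofGraph G) ∧
      G.treeWidth ≤ MonoidalWidth.rightTreeWidth CospanGraph.weight (CospanGraph.ofGraph G) ∧
      MonoidalWidth.rightTreeWidth CospanGraph.weight (CospanGraph.ofGraph G) ≤
        2 * G.treeWidth := by
  exact ⟨CospanGraph.leftTreeWidth_ofGraph G, CospanGraph.treeWidth_le_rightTreeWidth G,
    CospanGraph.rightTreeWidth_le_two_mul_treeWidth G⟩
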